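/- For each $n\ge 1$ let $X_1,\dots,X_n$ (where $X_i=X_{n,i}$, a triangular array) be independent real random variables whose laws are absolutely continuous with respect to Lebesgue measure; the laws may differ over $i$ and change with $n$. Let $$U_n^{\rm Ken}=U_n^{\rm Ken}(X_1,\dots,X_n)=\frac{1}{n(n-1)}\sum_{i\ne j}\mathbf 1(j<i)\,\mathbf 1(X_j>X_i)$$ be the (rescaled) Kendall's tau and $\sigma_n^2=\operatorname{Var}(U_n^{\rm Ken})$, $\sigma_n\ge 0$. Given $X_1,\dots,X_n$, let $X_1^*,\dots,X_n^*$ be i.i.d. draws from the empirical distribution of $X_1,\dots,X_n$, let $U_n^{{\rm Ken}*}=U_n^{\rm Ken}(X_1^*,\dots,X_n^*)$, and let $\operatorname{Var}^*$ be the conditional variance given $X_1,\dots,X_n$. Assume: 1. There are sequences $\delta_n,p_n\in(0,1)$ such that for all sufficiently large $n$ and each $i\in\{1,\dots,n\}$, at least one of the following holds: (i) $P\{P(X_j>X_i\mid X_i)-P(X_j>X_i)\in[\delta_n,1]\ \text{for all } j\ne i\}\ge p_n$; (ii) $P\{P(X_j>X_i\mid X_i)-P(X_j>X_i)\in[-1,-\delta_n]\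 \text{for all } j\ne i\}\ge p_n$. 2. $\delta_n^3p_n$ strictly dominates $n^{-1/3}$: $n^{-1/3}=O(\delta_n^3p_n)$, but $\delta_n^3p_n=O(n^{-1/3})$ fails. 3. There exist $\theta>0$ and $C>0$, not depending on $n$, such that for all $n$ and all $1\le i\ne j\le n$, $\ |P(X_i>X_j)-\theta|\le Cn^{-1/6}$. 4. There exist $\eta^2>0$ and $C'>0$, not depending on $n$, such that for all $n$ and all $1\le i,j,k\le n$ with $j\ne i$ and $k\ne i$ (the case $j=k$ included), $$\big|E\{P(X_j>X_i\mid X_i)\,P(X_k>X_i\mid X_i)\}-\eta^2\big|\le C'n^{-1/3}.$$ 5. $\eta^2\ne\theta^2$. Then $\sigma_n>0$ for all sufficiently large $n$, and Efron's bootstrap variance estimate is consistent: $$\big|\operatorname{Var}^*(\sigma_n^{-1}U_n^{{\rm Ken}*})-\operatorname{Var}(\sigma_n^{-1}U_n^{\rm Ken})\big|\xrightarrow{P}0 .$$ -/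

import Mathlib

open MeasureTheory ProbabilityTheory Filter Topology

noncomputable section

namespace BootstrapKendall

/-- The strict order relation between real sequences: `b n ≲ a n` (there is a constant `C`
with `|b n| ≤ C * |a n|` for all large `n`), whereas `a n ≲ b n` fails. -/
def StrictlyDominates (a b : ℕ → ℝ) : Prop :=
  b =O[atTop] a ∧ ¬ a =O[atTop] b

/-- The rescaled Kendall's tau `(τ + 1) / 4`,
`1 / (n (n - 1)) * ∑_{i ≠ j} 1(j < i) 1(x_j > x_i)`. -/
def kendallU {n : ℕ} (x : Fin n → ℝ) : ℝ :=
  1 / ((n : ℝ) * ((n : ℝ) - 1)) *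
    ∑ q ∈ (Finset.univ : Finset (Fin n)).offDiag,
      (if q.2 < q.1 then (1 : ℝ) else 0) * (if x q.2 > x q.1 then (1 : ℝ) else 0)

/-- The empirical distribution of `x_1, …, x_n`: mass `1 / n` at each of the points. -/
def empiricalLaw {n : ℕ} (x : Fin n → ℝ) : Measure ℝ :=
  (n : ENNReal)⁻¹ • ∑ i, Measure.dirac (x i)

/-- The law of an Efron bootstrap sample of size `n` given the data `x`:
`n` i.i.d. draws from the empirical distribution of `x`. -/
def bootstrapLaw {n : ℕ} (x : Fin n → ℝ) : Measure (Fin n → ℝ) :=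
  Measure.pi fun _ => empiricalLaw x

/-- The bootstrap variance `Var*(T(X*_1, …, X*_n))` of a statistic `T` given the data `x`. -/
def bootstrapVar {n : ℕ} (T : (Fin n → ℝ) → ℝ) (x : Fin n → ℝ) : ℝ :=
  variance T (bootstrapLaw x)

section RandomSample

variable {Ω : Type*} [MeasurableSpace Ω] {n : ℕ}

/-- `P(X_j > X_i)`. -/
def probGT (P : Measure Ω) (X : Fin n → Ω → ℝ) (j i : Fin n) : ℝ :=
  P.real {ω | X j ω > X i ω}

/-- The conditional probability `P(X_j > X_i | X_i)`, a random variable. -/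
def condProbGT (P : Measure Ω) (X : Fin n → Ω → ℝ) (j i : Fin n) : Ω → ℝ :=
  P[{ω | X j ω > X i ω}.indicator (fun _ => (1 : ℝ)) |
    MeasurableSpace.comap (X i) inferInstance]

/-- The standard deviation `σ_n` of the rescaled Kendall's tau of the sample. -/
def kendallSD (P : Measure Ω) (X : Fin n → Ω → ℝ) : ℝ :=
  √(variance (fun ω => kendallU fun i => X i ω) P)

end RandomSample

end BootstrapKendall

end

/-!
The variance of the number of inversions of a sample of size `n` is a sum of `O(n ^ 3)` covariances
of order indicators of pairs of observations. Disjoint pairs are independent, pairs with two common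
indices contribute only `O(n ^ 2)`, and when ties are rare replacing `X_i < X_k` by `X_k < X_i`
flips the sign of a covariance. So up to `o(n ^ 3)` the variance is determined by the probabilities
`P(X_i < X_j)` and `P(X_i < X_j, X_i < X_k)`. If these hardly depend on the indices they must be
close to `1 / 2` and `1 / 3`, since exactly one of two or three distinct values is the smallest.
Hence `θ = 1 / 2`, `η ^ 2 = 1 / 3`, and the variance is `n ^ 3 / 36 + o(n ^ 3)`. Given data without
ties, the bootstrap sample is i.i.d. with tie probability `1 / n`, so the same reasoning gives the
same leading term for its variance.
-/

namespace BootstrapKendall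

section Pairs

variable {ι : Type*} [DecidableEq ι]

/-- The index pairs `(i, j)` with `j < i`, over which Kendall's tau sums. -/
def descPairs (n : ℕ) : Finset (Fin n × Fin n) :=
  Finset.univ.filter fun q => q.2 < q.1

/-- The incidence vector of the edge `{i, j}` given by a pair `q = (i, j)`; the dot product of two
such vectors counts the coincidences between the entries of two pairs. -/
def incidence (q : ι × ι) : ι → ℝ :=
  Pi.single q.1 1 + Pi.single q.2 1

/-- The signed incidence vector of the oriented edge given by a pair `q = (i, j)`; the dot product
of two such vectors records how the orientations of two edges agree at common vertices. -/
def signedIncidence (q : ι × ι) : ι → ℝ :=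
  Pi.single q.1 1 - Pi.single q.2 1

lemma mem_descPairs {n : ℕ} {q : Fin n × Fin n} : q ∈ descPairs n ↔ q.2 < q.1 := by
  simp [descPairs]

lemma sum_descPairs {n : ℕ} (f : Fin n → Fin n → ℝ) :
    ∑ q ∈ descPairs n, f q.1 q.2 = ∑ i, ∑ j with j < i, f i j := by
  simp only [descPairs, Finset.sum_filter, ← Finset.univ_product_univ, Finset.sum_product]

lemma sum_descPairs_single_fst {n : ℕ} (a : Fin n) :
    ∑ q ∈ descPairs n, (Pi.single q.1 1 : Fin n → ℝ) a = a := by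
  rw [sum_descPairs fun i _ => (Pi.single i 1 : Fin n → ℝ) a]
  simp [Pi.single_apply, Finset.filter_gt_eq_Iio]

lemma sum_descPairs_single_snd {n : ℕ} (a : Fin n) :
    ∑ q ∈ descPairs n, (Pi.single q.2 1 : Fin n → ℝ) a = n - 1 - a := by
  have hcard : ((n - 1 - a : ℕ) : ℝ) = n - 1 - a := by
    have ha := a.isLt
    rw [Nat.cast_sub (by omega), Nat.cast_sub (by omega), Nat.cast_one]
  rw [sum_descPairs fun _ j => (Pi.single j 1 : Fin n → ℝ) a]
  simp_rw [Finset.sum_filter]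
  rw [Finset.sum_comm, Finset.sum_eq_single a (by simp +contextual) (by simp)]
  simp [Finset.filter_lt_eq_Ioi, hcard]

lemma sum_incidence (n : ℕ) : ∑ q ∈ descPairs n, incidence q = fun _ => (n : ℝ) - 1 := by
  ext a
  simp only [incidence, Finset.sum_apply, Pi.add_apply, Finset.sum_add_distrib,
    sum_descPairs_single_fst, sum_descPairs_single_snd]
  ring

lemma sum_signedIncidence (n : ℕ) :
    ∑ q ∈ descPairs n, signedIncidence q = fun a : Fin n => 2 * (a : ℝ) - (n - 1) := by
  ext a
  simp only [signedIncidence, Finset.sum_apply, Pi.sub_apply, Finset.sum_sub_distrib,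
    sum_descPairs_single_fst, sum_descPairs_single_snd]
  ring

lemma sum_incidence_dotProduct (n : ℕ) :
    ∑ q ∈ descPairs n, ∑ r ∈ descPairs n, incidence q ⬝ᵥ incidence r
      = n * ((n : ℝ) - 1) ^ 2 := by
  simp_rw [← dotProduct_sum, ← sum_dotProduct, sum_incidence]
  simp [dotProduct, sq]

lemma sum_range_sq_two_mul_sub (c : ℝ) (m : ℕ) :
    ∑ a ∈ Finset.range m, (2 * (a : ℝ) - c) ^ 2
      = 2 * m * (m - 1) * (2 * m - 1) / 3 - 2 * c * m * (m - 1) + m * c ^ 2 := by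
  induction m with
  | zero => simp
  | succ k ih => rw [Finset.sum_range_succ, ih]; push_cast; ring

lemma sum_signedIncidence_dotProduct (n : ℕ) :
    ∑ q ∈ descPairs n, ∑ r ∈ descPairs n, signedIncidence q ⬝ᵥ signedIncidence r
      = n * ((n : ℝ) ^ 2 - 1) / 3 := by
  simp_rw [← dotProduct_sum, ← sum_dotProduct, sum_signedIncidence, dotProduct, ← sq]
  rw [Fin.sum_univ_eq_sum_range fun a => (2 * (a : ℝ) - (n - 1)) ^ 2, sum_range_sq_two_mul_sub]
  ring

lemma card_descPairs_le (n : ℕ) : ((descPairs n).card : ℝ) ≤ (n : ℝ) ^ 2 := by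
  have hcard : (descPairs n).card ≤ n ^ 2 := by
    simpa [sq] using Finset.card_le_univ (descPairs n)
  exact_mod_cast hcard

/-- The number of pairs `j < i` with `x j > x i`, i.e. Kendall's tau before normalization. -/
def inversions {E : Type*} [LinearOrder E] {n : ℕ} (x : Fin n → E) : ℝ :=
  ∑ q ∈ descPairs n, if x q.1 < x q.2 then 1 else 0

lemma kendallU_eq_mul_inversions {n : ℕ} (x : Fin n → ℝ) :
    kendallU x = 1 / ((n : ℝ) * ((n : ℝ) - 1)) * inversions x := by
  have hsub : descPairs n ⊆ Finset.univ.offDiag := fun q hq => by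
    simpa using (mem_descPairs.1 hq).ne'
  rw [kendallU, inversions, ← Finset.sum_subset hsub fun q _ hq => by
    simp [mt mem_descPairs.2 hq]]
  refine congrArg _ (Finset.sum_congr rfl fun q hq => ?_)
  rw [if_pos (mem_descPairs.1 hq), one_mul]

end Pairs

section IndicatorCovariance

variable {Ω : Type*} [MeasurableSpace Ω] {P : Measure Ω} [IsProbabilityMeasure P] {A B : Set Ω}

lemma memLp_indicator_one {p : ENNReal} (hA : MeasurableSet A) :
    MemLp (A.indicator (1 : Ω → ℝ)) p P :=
  memLp_indicator_const p hA 1 (Or.inr (measure_ne_top P A))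

lemma covariance_indicator_one (hA : MeasurableSet A) (hB : MeasurableSet B) :
    cov[A.indicator (1 : Ω → ℝ), B.indicator (1 : Ω → ℝ); P]
      = P.real (A ∩ B) - P.real A * P.real B := by
  rw [covariance_eq_sub (memLp_indicator_one hA) (memLp_indicator_one hB),
    ← Set.inter_indicator_one, integral_indicator_one (hA.inter hB), integral_indicator_one hA,
    integral_indicator_one hB]

lemma abs_covariance_indicator_one_le (hA : MeasurableSet A) (hB : MeasurableSet B) :
    |cov[A.indicator (1 : Ω → ℝ), B.indicator (1 : Ω → ℝ); P]| ≤ P.real B := by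
  have hinter : P.real (A ∩ B) ≤ P.real B := measureReal_mono Set.inter_subset_right
  have hmul : P.real A * P.real B ≤ P.real B :=
    mul_le_of_le_one_left measureReal_nonneg measureReal_le_one
  rw [covariance_indicator_one hA hB]
  exact abs_sub_le_of_nonneg_of_le measureReal_nonneg hinter (by positivity) hmul

lemma covariance_indicator_one_self_mem_Icc (hA : MeasurableSet A) :
    cov[A.indicator (1 : Ω → ℝ), A.indicator (1 : Ω → ℝ); P] ∈ Set.Icc 0 1 := by
  refine ⟨?_, (le_abs_self _).trans
    ((abs_covariance_indicator_one_le hA hA).trans measureReal_le_one)⟩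
  rw [covariance_self (measurable_one.indicator hA).aemeasurable]
  exact variance_nonneg _ _

variable {E : Type*} [LinearOrder E] [TopologicalSpace E] [OrderClosedTopology E]
  [SecondCountableTopology E] [MeasurableSpace E] [OpensMeasurableSpace E] {U V : Ω → E}

lemma abs_covariance_lt_add_covariance_gt_le (hA : MeasurableSet A) (hU : Measurable U)
    (hV : Measurable V) :
    |cov[A.indicator (1 : Ω → ℝ), {ω | U ω < V ω}.indicator (1 : Ω → ℝ); P]
      + cov[A.indicator (1 : Ω → ℝ), {ω | V ω < U ω}.indicator (1 : Ω → ℝ); P]|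
      ≤ P.real {ω | U ω = V ω} := by
  have hlt := measurableSet_lt hU hV
  have hgt := measurableSet_lt hV hU
  have heq : MeasurableSet {ω | U ω = V ω} := measurableSet_eq_fun hU hV
  have hone : {ω | U ω = V ω}.indicator (1 : Ω → ℝ)
      = fun ω => 1 - ({ω | U ω < V ω}.indicator (1 : Ω → ℝ)
          + {ω | V ω < U ω}.indicator (1 : Ω → ℝ)) ω := by
    ext ω
    rcases lt_trichotomy (U ω) (V ω) with h | h | h
    · simp [h, h.not_gt, h.ne]
    · simp [h]
    · simp [h, h.not_gt, h.ne']
  have hcov := abs_covariance_indicator_one_le (P := P) hA heq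
  rwa [hone, covariance_const_sub_right (((memLp_indicator_one hlt).add
    (memLp_indicator_one hgt)).integrable one_le_two), covariance_add_right
    (memLp_indicator_one hA) (memLp_indicator_one hlt) (memLp_indicator_one hgt), abs_neg] at hcov

end IndicatorCovariance


section NearlyUniformRanks

variable {ι Ω E : Type*} [MeasurableSpace Ω] [LinearOrder E] [MeasurableSpace E]
  {P : Measure Ω} {Y : ι → Ω → E} {ε : ℝ} {i j k : ι}

/-- The event that the `i`-th member of the sample `Y` is smaller than the `j`-th. -/
def ltEvent {ι Ω E : Type*} [LT E] (Y : ι → Ω → E) (i j : ι) : Set Ω :=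
  {ω | Y i ω < Y j ω}

/-- The sample `Y` is independent, and up to an error `ε` its members have no ties, the smaller of
two of them is equally likely to be either one, and the smallest of three is equally likely to be
any of them. -/
structure NearlyUniformRanks (P : Measure Ω) (Y : ι → Ω → E) (ε : ℝ) : Prop where
  measurable : ∀ i, Measurable (Y i)
  indep : iIndepFun Y P
  tie : ∀ i j, i ≠ j → P.real {ω | Y i ω = Y j ω} ≤ ε
  pair : ∀ i j, i ≠ j → |P.real (ltEvent Y i j) - 1 / 2| ≤ ε
  triple : ∀ i j k, i ≠ j → i ≠ k → j ≠ k →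
    |P.real (ltEvent Y i j ∩ ltEvent Y i k) - 1 / 3| ≤ ε

namespace NearlyUniformRanks

lemma nonneg (h : NearlyUniformRanks P Y ε) (hij : i ≠ j) : 0 ≤ ε :=
  measureReal_nonneg.trans (h.tie i j hij)

end NearlyUniformRanks

variable [TopologicalSpace E] [OrderClosedTopology E] [SecondCountableTopology E]
  [OpensMeasurableSpace E]

lemma measurableSet_ltEvent (hY : ∀ i, Measurable (Y i)) (i j : ι) :
    MeasurableSet (ltEvent Y i j) :=
  measurableSet_lt (hY i) (hY j)

namespace NearlyUniformRanks

variable [IsProbabilityMeasure P]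

lemma abs_covariance_lt_lt_sub_le (h : NearlyUniformRanks P Y ε)
    (hij : i ≠ j) (hik : i ≠ k) (hjk : j ≠ k) :
    |cov[(ltEvent Y i j).indicator (1 : Ω → ℝ), (ltEvent Y i k).indicator (1 : Ω → ℝ); P]
      - 1 / 12| ≤ 3 * ε := by
  have hm := measurableSet_ltEvent h.measurable
  have hj := abs_le.1 (h.pair i j hij)
  have hk := abs_le.1 (h.pair i k hik)
  have htriple := abs_le.1 (h.triple i j k hij hik hjk)
  have hk0 : 0 ≤ P.real (ltEvent Y i k) := measureReal_nonneg
  have hk1 : P.real (ltEvent Y i k) ≤ 1 := measureReal_le_one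
  rw [covariance_indicator_one (hm i j) (hm i k), abs_le]
  constructor <;> nlinarith

lemma abs_covariance_lt_gt_add_le (h : NearlyUniformRanks P Y ε)
    (hij : i ≠ j) (hik : i ≠ k) (hjk : j ≠ k) :
    |cov[(ltEvent Y i j).indicator (1 : Ω → ℝ), (ltEvent Y k i).indicator (1 : Ω → ℝ); P]
      + 1 / 12| ≤ 4 * ε := by
  have hswap := abs_le.1 ((abs_covariance_lt_add_covariance_gt_le
    (measurableSet_ltEvent h.measurable i j) (h.measurable i) (h.measurable k)).trans
      (h.tie i k hik))
  have hleft := abs_le.1 (h.abs_covariance_lt_lt_sub_le hij hik hjk)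
  simp only [ltEvent] at hswap hleft ⊢
  exact abs_le.2 ⟨by linarith, by linarith⟩

lemma abs_covariance_gt_gt_sub_le (h : NearlyUniformRanks P Y ε)
    (hij : i ≠ j) (hik : i ≠ k) (hjk : j ≠ k) :
    |cov[(ltEvent Y j i).indicator (1 : Ω → ℝ), (ltEvent Y k i).indicator (1 : Ω → ℝ); P]
      - 1 / 12| ≤ 5 * ε := by
  have hswap := abs_le.1 ((abs_covariance_lt_add_covariance_gt_le
    (measurableSet_ltEvent h.measurable j i) (h.measurable i) (h.measurable k)).trans
      (h.tie i k hik))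
  have hmid := abs_le.1 (h.abs_covariance_lt_gt_add_le hik hij hjk.symm)
  rw [covariance_comm] at hmid
  simp only [ltEvent] at hswap hmid ⊢
  exact abs_le.2 ⟨by linarith, by linarith⟩

lemma covariance_eq_zero (h : NearlyUniformRanks P Y ε) {l : ι}
    (hik : i ≠ k) (hil : i ≠ l) (hjk : j ≠ k) (hjl : j ≠ l) :
    cov[(ltEvent Y i j).indicator (1 : Ω → ℝ), (ltEvent Y k l).indicator (1 : Ω → ℝ); P] = 0 := by
  have hm := measurableSet_ltEvent h.measurable
  have hS : MeasurableSet {z : E × E | z.1 < z.2} := measurableSet_lt measurable_fst measurable_snd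
  have hind := h.indep.indepFun_prodMk_prodMk h.measurable i j k l hik hil hjk hjl
  rw [covariance_indicator_one (hm i j) (hm k l), sub_eq_zero]
  exact congrArg ENNReal.toReal (hind.measure_inter_preimage_eq_mul _ _ hS hS) |>.trans
    ENNReal.toReal_mul

lemma abs_covariance_sub_le [Fintype ι] [LinearOrder ι] (h : NearlyUniformRanks P Y ε)
    {q r : ι × ι} (hq : q.2 < q.1) (hr : r.2 < r.1) :
    |cov[(ltEvent Y q.1 q.2).indicator (1 : Ω → ℝ), (ltEvent Y r.1 r.2).indicator (1 : Ω → ℝ); P]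
        - signedIncidence q ⬝ᵥ signedIncidence r / 12|
      ≤ 5 * ε * (incidence q ⬝ᵥ incidence r) + if q = r then 1 else 0 := by
  obtain ⟨i, j⟩ := q
  obtain ⟨k, l⟩ := r
  have hε := h.nonneg hq.ne
  simp only [signedIncidence, incidence, sub_dotProduct, add_dotProduct, single_dotProduct,
    Pi.sub_apply, Pi.add_apply, Pi.single_apply, Prod.mk.injEq]
  change j < i at hq
  change l < k at hr
  rcases eq_or_ne i k with rfl | hik
  · rcases eq_or_ne j l with rfl | hjl
    · obtain ⟨hge, hle⟩ := covariance_indicator_one_self_mem_Icc (P := P)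
        (measurableSet_ltEvent h.measurable i j)
      simp only [hq.ne, hq.ne', if_true, if_false, and_self]
      exact abs_le.2 ⟨by linarith, by linarith⟩
    · have hleft := h.abs_covariance_lt_lt_sub_le hq.ne' hr.ne' hjl
      simpa [hq.ne, hr.ne', hjl] using hleft.trans (by linarith : _ ≤ 5 * ε)
  rcases eq_or_ne j l with rfl | hjl
  · have hright := h.abs_covariance_gt_gt_sub_le hq.ne hr.ne hik
    simpa [hq.ne', hr.ne, hik] using hright
  rcases eq_or_ne i l with rfl | hil
  · have hmid := h.abs_covariance_lt_gt_add_le hq.ne' hr.ne (hq.trans hr).ne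
    simpa [hq.ne, hr.ne, (hq.trans hr).ne, neg_div] using hmid.trans (by linarith : _ ≤ 5 * ε)
  rcases eq_or_ne j k with rfl | hjk
  · have hmid := h.abs_covariance_lt_gt_add_le hr.ne' hq.ne (hr.trans hq).ne
    rw [covariance_comm] at hmid
    simpa [hq.ne', hr.ne', hil, neg_div] using hmid.trans (by linarith : _ ≤ 5 * ε)
  · simp [h.covariance_eq_zero hik hil hjk hjl, hik, hil, hjk, hjl]

lemma abs_variance_inversions_sub_le {n : ℕ} {Y : Fin n → Ω → E} (h : NearlyUniformRanks P Y ε) :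
    |Var[fun ω => inversions fun i => Y i ω; P] - n * ((n : ℝ) ^ 2 - 1) / 36|
      ≤ 5 * ε * (n * ((n : ℝ) - 1) ^ 2) + (n : ℝ) ^ 2 := by
  let c : Fin n × Fin n → Fin n × Fin n → ℝ := fun q r =>
    cov[(ltEvent Y q.1 q.2).indicator (1 : Ω → ℝ), (ltEvent Y r.1 r.2).indicator (1 : Ω → ℝ); P]
  have hvar : Var[fun ω => inversions fun i => Y i ω; P]
      = ∑ q ∈ descPairs n, ∑ r ∈ descPairs n, c q r := by
    rw [← variance_fun_sum' fun q _ => memLp_indicator_one (measurableSet_ltEvent h.measurable _ _)]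
    simp [inversions, ltEvent, Set.indicator_apply]
  have hmain : (n : ℝ) * ((n : ℝ) ^ 2 - 1) / 36
      = ∑ q ∈ descPairs n, ∑ r ∈ descPairs n, signedIncidence q ⬝ᵥ signedIncidence r / 12 := by
    simp_rw [← Finset.sum_div, sum_signedIncidence_dotProduct]
    ring
  rw [hvar, hmain]
  simp_rw [← Finset.sum_sub_distrib]
  calc |∑ q ∈ descPairs n, ∑ r ∈ descPairs n, (c q r - signedIncidence q ⬝ᵥ signedIncidence r / 12)|
      ≤ ∑ q ∈ descPairs n, ∑ r ∈ descPairs n,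
          |c q r - signedIncidence q ⬝ᵥ signedIncidence r / 12| :=
        (Finset.abs_sum_le_sum_abs _ _).trans
          (Finset.sum_le_sum fun _ _ => Finset.abs_sum_le_sum_abs _ _)
    _ ≤ ∑ q ∈ descPairs n, ∑ r ∈ descPairs n,
          (5 * ε * (incidence q ⬝ᵥ incidence r) + if q = r then 1 else 0) := by
        gcongr with q hq r hr
        exact h.abs_covariance_sub_le (mem_descPairs.1 hq) (mem_descPairs.1 hr)
    _ = 5 * ε * (n * ((n : ℝ) - 1) ^ 2) + (descPairs n).card := by
        simp_rw [Finset.sum_add_distrib, ← Finset.mul_sum, sum_incidence_dotProduct]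
        simp
    _ ≤ _ := by gcongr; exact card_descPairs_le n

end NearlyUniformRanks

end NearlyUniformRanks

section OrderProbabilities

variable {ι Ω E : Type*} [MeasurableSpace Ω] [LinearOrder E] [TopologicalSpace E]
  [OrderClosedTopology E] [SecondCountableTopology E] [MeasurableSpace E] [OpensMeasurableSpace E]
  {P : Measure Ω} [IsProbabilityMeasure P] {Y : ι → Ω → E} {τ : ℝ}

lemma measureReal_lt_add_gt_mem_Icc {U V : Ω → E} (hU : Measurable U) (hV : Measurable V)
    (htie : P.real {ω | U ω = V ω} ≤ τ) :
    P.real {ω | U ω < V ω} + P.real {ω | V ω < U ω} ∈ Set.Icc (1 - τ) 1 := by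
  have hdisj : Disjoint {ω | U ω < V ω} {ω | V ω < U ω} :=
    Set.disjoint_left.2 fun ω hlt hgt => lt_asymm hlt hgt
  have hcover : {ω | U ω < V ω} ∪ {ω | V ω < U ω} ∪ {ω | U ω = V ω} = Set.univ := by
    ext ω
    rcases lt_trichotomy (U ω) (V ω) with h | h | h <;> simp [h]
  rw [← measureReal_union hdisj (measurableSet_lt hV hU)]
  have hunion := measureReal_union_le (μ := P) ({ω | U ω < V ω} ∪ {ω | V ω < U ω})
    {ω | U ω = V ω}
  rw [hcover, probReal_univ] at hunion
  exact ⟨by linarith, measureReal_le_one⟩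

lemma measureReal_ltEvent_inter_add_mem_Icc (hY : ∀ i, Measurable (Y i)) {i j k : ι}
    (hij : P.real {ω | Y i ω = Y j ω} ≤ τ) (hik : P.real {ω | Y i ω = Y k ω} ≤ τ)
    (hjk : P.real {ω | Y j ω = Y k ω} ≤ τ) :
    P.real (ltEvent Y i j ∩ ltEvent Y i k) + P.real (ltEvent Y j i ∩ ltEvent Y j k)
      + P.real (ltEvent Y k i ∩ ltEvent Y k j) ∈ Set.Icc (1 - 3 * τ) 1 := by
  have hm := measurableSet_ltEvent hY
  have hdisj : Disjoint (ltEvent Y i j ∩ ltEvent Y i k) (ltEvent Y j i ∩ ltEvent Y j k) :=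
    Set.disjoint_left.2 fun ω h h' => lt_asymm (a := Y i ω) h.1 h'.1
  have hdisj' : Disjoint (ltEvent Y i j ∩ ltEvent Y i k ∪ ltEvent Y j i ∩ ltEvent Y j k)
      (ltEvent Y k i ∩ ltEvent Y k j) :=
    Set.disjoint_left.2 fun ω h h' => h.elim (fun h => lt_asymm (a := Y i ω) h.2 h'.1)
      fun h => lt_asymm (a := Y j ω) h.2 h'.2
  have hcover : ltEvent Y i j ∩ ltEvent Y i k ∪ ltEvent Y j i ∩ ltEvent Y j k
      ∪ ltEvent Y k i ∩ ltEvent Y k j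
      ∪ ({ω | Y i ω = Y j ω} ∪ {ω | Y i ω = Y k ω} ∪ {ω | Y j ω = Y k ω}) = Set.univ := by
    ext ω
    simp only [ltEvent, Set.mem_union, Set.mem_inter_iff, Set.mem_ofPred_eq, Set.mem_univ]
    grind
  rw [← measureReal_union hdisj ((hm j i).inter (hm j k)),
    ← measureReal_union hdisj' ((hm k i).inter (hm k j))]
  have hunion := congrArg P.real hcover
  have hties := (measureReal_union_le ({ω | Y i ω = Y j ω} ∪ {ω | Y i ω = Y k ω})
    {ω | Y j ω = Y k ω}).trans (add_le_add_left (measureReal_union_le (μ := P) _ _) _)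
  have hle := (hunion.symm.le.trans (measureReal_union_le _ _))
  rw [probReal_univ] at hle
  exact ⟨by linarith, measureReal_le_one⟩

lemma NearlyUniformRanks.of_nearly_exchangeable (hY : ∀ i, Measurable (Y i))
    (hind : iIndepFun Y P) {u : ℝ} (hu : 0 ≤ u)
    (htie : ∀ i j, i ≠ j → P.real {ω | Y i ω = Y j ω} ≤ τ)
    (hpair : ∀ i j, i ≠ j → |P.real (ltEvent Y i j) - P.real (ltEvent Y j i)| ≤ u)
    (htriple : ∀ i j k, i ≠ j → i ≠ k → j ≠ k →
      |P.real (ltEvent Y i j ∩ ltEvent Y i k) - P.real (ltEvent Y j i ∩ ltEvent Y j k)| ≤ u) :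
    NearlyUniformRanks P Y (u + τ) where
  measurable := hY
  indep := hind
  tie i j hij := (htie i j hij).trans (le_add_of_nonneg_left hu)
  pair i j hij := by
    obtain ⟨hge, hle⟩ := measureReal_lt_add_gt_mem_Icc (hY i) (hY j) (htie i j hij)
    have hswap := abs_le.1 (hpair i j hij)
    simp only [ltEvent] at hswap ⊢
    exact abs_le.2 ⟨by linarith, by linarith⟩
  triple i j k hij hik hjk := by
    obtain ⟨hge, hle⟩ := measureReal_ltEvent_inter_add_mem_Icc hY (htie i j hij) (htie i k hik)
      (htie j k hjk)
    have hj := abs_le.1 (htriple i j k hij hik hjk)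
    have hk := abs_le.1 (htriple i k j hik hij hjk.symm)
    rw [Set.inter_comm (ltEvent Y i k)] at hk
    exact abs_le.2 ⟨by linarith, by linarith⟩

lemma NearlyUniformRanks.of_identDistrib (hY : ∀ i, Measurable (Y i)) (hind : iIndepFun Y P)
    (hident : ∀ i j, IdentDistrib (Y i) (Y j) P P)
    (htie : ∀ i j, i ≠ j → P.real {ω | Y i ω = Y j ω} ≤ τ) : NearlyUniformRanks P Y τ := by
  have hlt : MeasurableSet {z : E × E | z.1 < z.2} := measurableSet_lt measurable_fst measurable_snd
  have hmin : MeasurableSet {z : (E × E) × E | z.1.1 < z.1.2 ∧ z.1.1 < z.2} :=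
    (measurable_fst hlt).inter (measurableSet_lt (measurable_fst.comp measurable_fst)
      measurable_snd)
  have hpair (i j : ι) (hij : i ≠ j) :
      IdentDistrib (fun ω => (Y i ω, Y j ω)) (fun ω => (Y j ω, Y i ω)) P P :=
    (hident i j).prodMk (hident j i) (hind.indepFun hij) (hind.indepFun hij.symm)
  have htriple : ∀ {i j k : ι}, i ≠ j → i ≠ k → j ≠ k →
      P.real (ltEvent Y i j ∩ ltEvent Y i k) = P.real (ltEvent Y j i ∩ ltEvent Y j k) :=
    fun {i j k} hij hik hjk => congrArg ENNReal.toReal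
      (((hpair i j hij).prodMk (hident k k) (hind.indepFun_prodMk hY i j k hik hjk)
        (hind.indepFun_prodMk hY j i k hjk hik)).measure_mem_eq hmin)
  have hranks := NearlyUniformRanks.of_nearly_exchangeable hY hind le_rfl htie
    (fun i j hij => (abs_eq_zero.2 (sub_eq_zero.2 (congrArg ENNReal.toReal
      ((hpair i j hij).measure_mem_eq hlt)))).le)
    fun i j k hij hik hjk => (abs_eq_zero.2 (sub_eq_zero.2 (htriple hij hik hjk))).le
  rwa [zero_add] at hranks

end OrderProbabilities

section Independence

variable {Ω E F : Type*} [MeasurableSpace Ω] [MeasurableSpace E] [MeasurableSpace F]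
  {P : Measure Ω} [IsProbabilityMeasure P] {U : Ω → E} {V : Ω → F} {S : Set (E × F)}

lemma measureReal_preimage_prodMk_of_indepFun (hU : Measurable U) (hV : Measurable V)
    (hind : U ⟂ᵢ[P] V) (hS : MeasurableSet S) :
    P.real ((fun ω => (U ω, V ω)) ⁻¹' S) = ∫ ω, (P.map V).real (Prod.mk (U ω) ⁻¹' S) ∂P := by
  have := Measure.isProbabilityMeasure_map (μ := P) hV.aemeasurable
  simp only [measureReal_def]
  rw [integral_toReal (f := fun ω => P.map V (Prod.mk (U ω) ⁻¹' S))
      ((measurable_measure_prodMk_left hS).comp hU).aemeasurable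
      (ae_of_all _ fun ω => measure_lt_top _ _), ← lintegral_map
      (measurable_measure_prodMk_left hS) hU, ← Measure.prod_apply hS,
    ← (indepFun_iff_map_prod_eq_prod_map_map hU.aemeasurable hV.aemeasurable).1 hind,
    Measure.map_apply (hU.prodMk hV) hS]

lemma condExp_preimage_prodMk_ae_eq_of_indepFun [StandardBorelSpace F] [Nonempty F]
    (hU : Measurable U) (hV : Measurable V) (hind : U ⟂ᵢ[P] V) (hS : MeasurableSet S) :
    P[((fun ω => (U ω, V ω)) ⁻¹' S).indicator (1 : Ω → ℝ) | MeasurableSpace.comap U inferInstance]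
      =ᵐ[P] fun ω => (P.map V).real (Prod.mk (U ω) ⁻¹' S) := by
  have := Measure.isProbabilityMeasure_map (μ := P) hV.aemeasurable
  have hlaw : condDistrib V U P =ᵐ[P.map U] Kernel.const E (P.map V) := by
    refine condDistrib_ae_eq_of_measure_eq_compProd U hV.aemeasurable ?_
    rw [Measure.compProd_const,
      (indepFun_iff_map_prod_eq_prod_map_map hU.aemeasurable hV.aemeasurable).1 hind]
  have hcond := condExp_prod_ae_eq_integral_condDistrib (μ := P) (f := S.indicator (1 : E × F → ℝ))
    hU hV.aemeasurable (stronglyMeasurable_one.indicator hS)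
    ((integrable_const (1 : ℝ)).indicator (hU.prodMk hV hS))
  filter_upwards [hcond, ae_of_ae_map hU.aemeasurable hlaw] with ω hω hlawω
  rw [← integral_indicator_one (measurable_prodMk_left hS)]
  exact hω.trans (by rw [hlawω, Kernel.const_apply]; rfl)

lemma measureReal_eq_le_of_indepFun {W : Ω → E} [MeasurableEq E] (hU : Measurable U)
    (hW : Measurable W) (hind : U ⟂ᵢ[P] W) {τ : ℝ} (hτ : ∀ x, (P.map W).real {x} ≤ τ) :
    P.real {ω | U ω = W ω} ≤ τ := by
  have hsection : ∀ x : E, Prod.mk x ⁻¹' Set.diagonal E = {x} := fun x => by ext; simp [eq_comm]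
  have := Measure.isProbabilityMeasure_map (μ := P) hW.aemeasurable
  calc P.real {ω | U ω = W ω}
      = ∫ ω, (P.map W).real {U ω} ∂P := by
        simp_rw [← hsection,
          ← measureReal_preimage_prodMk_of_indepFun hU hW hind measurableSet_diagonal]
        rfl
    _ ≤ ∫ _, τ ∂P := integral_mono_of_nonneg (ae_of_all _ fun _ => measureReal_nonneg)
        (integrable_const _) (ae_of_all _ fun ω => hτ (U ω))
    _ = τ := by simp

lemma ae_injective_of_pairwise_indepFun {ι : Type*} [Countable ι] {Y : ι → Ω → E}
    [MeasurableEq E] (hY : ∀ i, Measurable (Y i)) (hind : Pairwise fun i j => Y i ⟂ᵢ[P] Y j)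
    [∀ i, NullSingletonClass (P.map (Y i))] : ∀ᵐ ω ∂P, Function.Injective fun i => Y i ω := by
  have hne : ∀ i j, i ≠ j → ∀ᵐ ω ∂P, Y i ω ≠ Y j ω := fun i j hij => by
    have hnull := (measureReal_eq_le_of_indepFun (hY i) (hY j) (hind hij) (τ := 0)
      fun x => by simp [measureReal_def]).antisymm measureReal_nonneg
    simpa [ae_iff, measureReal_eq_zero_iff] using hnull
  filter_upwards [ae_all_iff.2 fun i => ae_all_iff.2 fun j =>
    eventually_imp_distrib_left.2 (hne i j)] with ω hω i j hij
  exact by_contra fun h => hω i j h hij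

end Independence

section Sample

variable {Ω : Type*} [MeasurableSpace Ω] {n : ℕ} {P : Measure Ω} {Y : Fin n → Ω → ℝ} {ε : ℝ}

section InversionVar

variable {E : Type*} [LinearOrder E]

/-- The variance of the number of inversions of a sample of size `n`, in units of its order of
magnitude `n ^ 3`. -/
noncomputable def inversionVar (P : Measure Ω) (Y : Fin n → Ω → E) : ℝ :=
  Var[fun ω => inversions fun i => Y i ω; P] / (n : ℝ) ^ 3

lemma NearlyUniformRanks.abs_inversionVar_sub_le [TopologicalSpace E] [OrderClosedTopology E]
    [SecondCountableTopology E] [MeasurableSpace E] [OpensMeasurableSpace E]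
    [IsProbabilityMeasure P] {Y : Fin n → Ω → E} (h : NearlyUniformRanks P Y ε) (hn : 2 ≤ n) :
    |inversionVar P Y - 1 / 36| ≤ 5 * ε + 2 / n := by
  have hn' : (2 : ℝ) ≤ n := by exact_mod_cast hn
  have hε : 0 ≤ ε := h.nonneg (i := (⟨0, by omega⟩ : Fin n)) (j := ⟨1, by omega⟩) (by simp)
  have hvar := abs_le.1 h.abs_variance_inversions_sub_le
  have herr : 5 * ε * (n * ((n : ℝ) - 1) ^ 2) ≤ 5 * ε * (n : ℝ) ^ 3 := by
    rw [pow_succ' (n : ℝ) 2]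
    gcongr <;> linarith
  have hsq : (n : ℝ) ≤ (n : ℝ) ^ 2 := by nlinarith
  have hscale : (5 * ε + 2 / n) * (n : ℝ) ^ 3 = 5 * ε * (n : ℝ) ^ 3 + 2 * (n : ℝ) ^ 2 := by
    field_simp
  rw [inversionVar, div_sub' (by positivity), abs_div, abs_of_pos (by positivity : 0 < (n : ℝ) ^ 3),
    div_le_iff₀ (by positivity), hscale, abs_le]
  constructor <;> linarith

end InversionVar

lemma variance_kendallU (P : Measure Ω) (Y : Fin n → Ω → ℝ) :
    Var[fun ω => kendallU fun i => Y i ω; P]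
      = n / ((n : ℝ) - 1) ^ 2 * inversionVar P Y := by
  simp_rw [kendallU_eq_mul_inversions, variance_const_mul, inversionVar]
  rcases eq_or_ne (n : ℝ) 0 with hn | hn
  · simp [hn]
  · field_simp

lemma kendallSD_pos (hn : 2 ≤ n) (hV : 0 < inversionVar P Y) : 0 < kendallSD P Y := by
  have hn' : (2 : ℝ) ≤ n := by exact_mod_cast hn
  have hn1 : (0 : ℝ) < n - 1 := by linarith
  rw [kendallSD, Real.sqrt_pos, variance_kendallU]
  positivity

lemma bootstrapVar_sub_variance (hsd : 0 < kendallSD P Y) (x : Fin n → ℝ) :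
    bootstrapVar (fun x => (kendallSD P Y)⁻¹ * kendallU x) x
        - Var[fun ω => (kendallSD P Y)⁻¹ * kendallU (fun i => Y i ω); P]
      = inversionVar (bootstrapLaw x) (fun i y => y i) / inversionVar P Y - 1 := by
  have hsq : kendallSD P Y ^ 2 = n / ((n : ℝ) - 1) ^ 2 * inversionVar P Y := by
    rw [kendallSD, Real.sq_sqrt (variance_nonneg _ _), variance_kendallU]
  have hne := hsq ▸ (pow_pos hsd 2).ne'
  have hboot : Var[kendallU; bootstrapLaw x]
      = n / ((n : ℝ) - 1) ^ 2 * inversionVar (bootstrapLaw x) fun i y => y i :=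
    variance_kendallU (bootstrapLaw x) fun i y => y i
  rw [bootstrapVar, variance_const_mul, variance_const_mul, hboot, variance_kendallU, inv_pow, hsq,
    inv_mul_cancel₀ hne, ← div_eq_inv_mul, mul_div_mul_left _ _ (left_ne_zero_of_mul hne)]

lemma isProbabilityMeasure_empiricalLaw (hn : n ≠ 0) (x : Fin n → ℝ) :
    IsProbabilityMeasure (empiricalLaw x) := by
  refine ⟨?_⟩
  simp [empiricalLaw, ENNReal.inv_mul_cancel, hn]

lemma isProbabilityMeasure_bootstrapLaw (hn : n ≠ 0) (x : Fin n → ℝ) :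
    IsProbabilityMeasure (bootstrapLaw x) := by
  have := isProbabilityMeasure_empiricalLaw hn x
  unfold bootstrapLaw
  infer_instance

lemma empiricalLaw_real_singleton_le {x : Fin n → ℝ} (hx : Function.Injective x) (y : ℝ) :
    (empiricalLaw x).real {y} ≤ 1 / n := by
  have hcount : (∑ i, Measure.dirac (x i)) {y} ≤ 1 := by
    simp only [Measure.finsetSum_apply, measurableSet_singleton, Measure.dirac_apply',
      Set.indicator_apply, Set.mem_singleton_iff, Pi.one_apply]
    by_cases hy : ∃ i, x i = y
    · obtain ⟨i, rfl⟩ := hy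
      simp [hx.eq_iff]
    · simp [not_exists.1 hy]
  rw [measureReal_def, empiricalLaw, Measure.smul_apply, smul_eq_mul, ENNReal.toReal_mul,
    ENNReal.toReal_inv, ENNReal.toReal_natCast, one_div]
  exact mul_le_of_le_one_right (by positivity) (ENNReal.toReal_mono ENNReal.one_ne_top hcount)

lemma nearlyUniformRanks_bootstrapLaw (hn : n ≠ 0) {x : Fin n → ℝ} (hx : Function.Injective x) :
    NearlyUniformRanks (bootstrapLaw x) (fun i y => y i) (1 / n) := by
  have := isProbabilityMeasure_empiricalLaw hn x
  have := isProbabilityMeasure_bootstrapLaw hn x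
  have hlaw : ∀ i, (bootstrapLaw x).map (fun y => y i) = empiricalLaw x := fun i =>
    (measurePreserving_eval (fun _ => empiricalLaw x) i).map_eq
  have hind : iIndepFun (fun i (y : Fin n → ℝ) => y i) (bootstrapLaw x) :=
    iIndepFun_pi (X := fun _ y => y) fun _ => aemeasurable_id
  refine NearlyUniformRanks.of_identDistrib measurable_pi_apply hind (fun i j =>
    ⟨(measurable_pi_apply i).aemeasurable, (measurable_pi_apply j).aemeasurable,
      (hlaw i).trans (hlaw j).symm⟩) fun i j hij => ?_
  exact measureReal_eq_le_of_indepFun (measurable_pi_apply i) (measurable_pi_apply j)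
    (hind.indepFun hij) fun y => hlaw j ▸ empiricalLaw_real_singleton_le hx y

variable [IsProbabilityMeasure P]

lemma NearlyUniformRanks.abs_bootstrapVar_sub_variance_le (h : NearlyUniformRanks P Y ε)
    (hn : 2 ≤ n) (hV : 0 < inversionVar P Y) {x : Fin n → ℝ} (hx : Function.Injective x) :
    |bootstrapVar (fun x => (kendallSD P Y)⁻¹ * kendallU x) x
        - Var[fun ω => (kendallSD P Y)⁻¹ * kendallU (fun i => Y i ω); P]|
      ≤ (5 * ε + 9 / n) / inversionVar P Y := by
  have hn0 : n ≠ 0 := by omega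
  have := isProbabilityMeasure_bootstrapLaw hn0 x
  have hboot := (nearlyUniformRanks_bootstrapLaw hn0 hx).abs_inversionVar_sub_le hn
  have hsample := h.abs_inversionVar_sub_le hn
  have hdiff := (abs_sub_le _ (1 / 36) _).trans
    (add_le_add hboot ((abs_sub_comm _ _).trans_le hsample))
  rw [bootstrapVar_sub_variance (kendallSD_pos hn hV), div_sub_one hV.ne', abs_div, abs_of_pos hV]
  gcongr
  exact hdiff.trans_eq (by ring)

lemma integral_condProbGT_mul (hY : ∀ i, Measurable (Y i)) (hind : iIndepFun Y P)
    {i j k : Fin n} (hij : i ≠ j) (hik : i ≠ k) (hjk : j ≠ k) :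
    ∫ ω, condProbGT P Y j i ω * condProbGT P Y k i ω ∂P
      = P.real (ltEvent Y i j ∩ ltEvent Y i k) := by
  have hlt : MeasurableSet {z : ℝ × ℝ | z.1 < z.2} := measurableSet_lt measurable_fst measurable_snd
  have hmin : MeasurableSet {z : ℝ × (ℝ × ℝ) | z.1 < z.2.1 ∧ z.1 < z.2.2} :=
    (measurableSet_lt measurable_fst (measurable_fst.comp measurable_snd)).inter
      (measurableSet_lt measurable_fst (measurable_snd.comp measurable_snd))
  have hcond : ∀ l, i ≠ l →
      condProbGT P Y l i =ᵐ[P] fun ω => (P.map (Y l)).real (Set.Ioi (Y i ω)) :=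
    fun l hil => condExp_preimage_prodMk_ae_eq_of_indepFun (hY i) (hY l) (hind.indepFun hil) hlt
  have := fun l => Measure.isProbabilityMeasure_map (μ := P) (hY l).aemeasurable
  calc ∫ ω, condProbGT P Y j i ω * condProbGT P Y k i ω ∂P
      = ∫ ω, (P.map (Y j)).real (Set.Ioi (Y i ω)) * (P.map (Y k)).real (Set.Ioi (Y i ω)) ∂P :=
        integral_congr_ae ((hcond j hij).mul (hcond k hik))
    _ = ∫ ω, (P.map fun ω => (Y j ω, Y k ω)).real (Set.Ioi (Y i ω) ×ˢ Set.Ioi (Y i ω)) ∂P := by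
        simp_rw [(indepFun_iff_map_prod_eq_prod_map_map (hY j).aemeasurable
          (hY k).aemeasurable).1 (hind.indepFun hjk), measureReal_prod_prod]
    _ = P.real (ltEvent Y i j ∩ ltEvent Y i k) :=
        (measureReal_preimage_prodMk_of_indepFun (hY i) ((hY j).prodMk (hY k))
          (hind.indepFun_prodMk hY j k i hij.symm hik.symm).symm hmin).symm

lemma nearlyUniformRanks_of_probGT (hY : ∀ i, Measurable (Y i)) (hind : iIndepFun Y P)
    [∀ i, NullSingletonClass (P.map (Y i))] {θ c u : ℝ} (hu : 0 ≤ u)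
    (hpair : ∀ i j, i ≠ j → |probGT P Y i j - θ| ≤ u)
    (htriple : ∀ i j k, i ≠ j → i ≠ k → j ≠ k →
      |∫ ω, condProbGT P Y j i ω * condProbGT P Y k i ω ∂P - c| ≤ u) :
    NearlyUniformRanks P Y (2 * u) := by
  rw [← add_zero (2 * u)]
  refine NearlyUniformRanks.of_nearly_exchangeable hY hind (by positivity) (fun i j hij => ?_)
    (fun i j hij => ?_) fun i j k hij hik hjk => ?_
  · exact measureReal_eq_le_of_indepFun (hY i) (hY j) (hind.indepFun hij)
      fun x => by simp [measureReal_def]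
  · have hlt := abs_le.1 (hpair j i hij.symm)
    have hgt := abs_le.1 (hpair i j hij)
    change |probGT P Y j i - probGT P Y i j| ≤ 2 * u
    exact abs_le.2 ⟨by linarith, by linarith⟩
  · have hi := abs_le.1 (htriple i j k hij hik hjk)
    have hj := abs_le.1 (htriple j i k hij.symm hjk hik)
    rw [← integral_condProbGT_mul hY hind hij hik hjk,
      ← integral_condProbGT_mul hY hind hij.symm hjk hik]
    exact abs_le.2 ⟨by linarith, by linarith⟩

end Sample

section TriangularArray

variable {Ω : ℕ → Type*} [∀ n, MeasurableSpace (Ω n)] {P : ∀ n, Measure (Ω n)}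

lemma tendsto_measure_of_eventually_ae_lt {f : ∀ n, Ω n → ℝ} {ε : ℝ}
    (h : ∀ᶠ n in atTop, ∀ᵐ ω ∂P n, f n ω < ε) :
    Tendsto (fun n => P n {ω | ε ≤ f n ω}) atTop (𝓝 0) := by
  refine tendsto_const_nhds.congr' ?_
  filter_upwards [h] with n hn
  simpa [ae_iff, eq_comm] using hn

variable [∀ n, IsProbabilityMeasure (P n)]

lemma tendsto_inversionVar {E : Type*} [LinearOrder E] [TopologicalSpace E] [OrderClosedTopology E]
    [SecondCountableTopology E] [MeasurableSpace E] [OpensMeasurableSpace E]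
    {X : ∀ n, Fin n → Ω n → E} {ε : ℕ → ℝ} (h : ∀ n, NearlyUniformRanks (P n) (X n) (ε n))
    (hε : Tendsto ε atTop (𝓝 0)) :
    Tendsto (fun n => inversionVar (P n) (X n)) atTop (𝓝 (1 / 36)) := by
  have hbound : Tendsto (fun n : ℕ => 5 * ε n + 2 / n) atTop (𝓝 0) := by
    simpa using (hε.const_mul 5).add (tendsto_const_div_atTop_nhds_zero_nat 2)
  refine tendsto_iff_norm_sub_tendsto_zero.2 (squeeze_zero' (.of_forall fun _ => norm_nonneg _) ?_
    hbound)
  filter_upwards [eventually_ge_atTop 2] with n hn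
  exact (h n).abs_inversionVar_sub_le hn

variable {X : ∀ n, Fin n → Ω n → ℝ} {ε : ℕ → ℝ}

lemma eventually_kendallSD_pos
    (h : ∀ n, NearlyUniformRanks (P n) (X n) (ε n)) (hε : Tendsto ε atTop (𝓝 0)) :
    ∀ᶠ n in atTop, 0 < kendallSD (P n) (X n) := by
  filter_upwards [eventually_ge_atTop 2, (tendsto_inversionVar h hε).eventually_const_lt
    (by norm_num : (0 : ℝ) < 1 / 36)] with n hn hV
  exact kendallSD_pos hn hV

lemma eventually_abs_bootstrapVar_sub_variance_lt
    (h : ∀ n, NearlyUniformRanks (P n) (X n) (ε n)) (hε : Tendsto ε atTop (𝓝 0)) {δ : ℝ}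
    (hδ : 0 < δ) :
    ∀ᶠ n in atTop, ∀ x : Fin n → ℝ, Function.Injective x →
      |bootstrapVar (fun x => (kendallSD (P n) (X n))⁻¹ * kendallU x) x
          - Var[fun ω => (kendallSD (P n) (X n))⁻¹ * kendallU (fun i => X n i ω); P n]| < δ := by
  have hnum : Tendsto (fun n : ℕ => 5 * ε n + 9 / n) atTop (𝓝 0) := by
    simpa using (hε.const_mul 5).add (tendsto_const_div_atTop_nhds_zero_nat 9)
  have hbound := hnum.div (tendsto_inversionVar h hε) (by norm_num)
  rw [zero_div] at hbound
  filter_upwards [eventually_ge_atTop 2, (tendsto_inversionVar h hε).eventually_const_lt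
    (by norm_num : (0 : ℝ) < 1 / 36), hbound.eventually_lt_const hδ] with n hn hV hlt x hx
  exact ((h n).abs_bootstrapVar_sub_variance_le hn hV hx).trans_lt hlt

end TriangularArray

lemma tendsto_const_mul_natCast_rpow_neg (c : ℝ) {s : ℝ} (hs : 0 < s) :
    Tendsto (fun n : ℕ => c * (n : ℝ) ^ (-s)) atTop (𝓝 0) := by
  simpa using ((tendsto_rpow_neg_atTop hs).comp tendsto_natCast_atTop_atTop).const_mul c

end BootstrapKendall

theorem mainTheorem9_general
    {Ω : ℕ → Type*} [∀ n, MeasurableSpace (Ω n)]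
    (P : ∀ n, Measure (Ω n)) [∀ n, IsProbabilityMeasure (P n)]
    (X : ∀ n, Fin n → Ω n → ℝ)
    (hmeas : ∀ n i, Measurable (X n i))
    (hindep : ∀ n, iIndepFun (X n) (P n))
    [∀ n i, NullSingletonClass ((P n).map (X n i))]
    (θ c : ℝ) (u v : ℕ → ℝ) (hu : Tendsto u atTop (𝓝 0)) (hv : Tendsto v atTop (𝓝 0))
    (hpair : ∀ n, ∀ i j : Fin n, i ≠ j →
      |BootstrapKendall.probGT (P n) (X n) i j - θ| ≤ u n)
    (htriple : ∀ n, ∀ i j k : Fin n, i ≠ j → i ≠ k → j ≠ k →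
      |(∫ ω, BootstrapKendall.condProbGT (P n) (X n) j i ω
          * BootstrapKendall.condProbGT (P n) (X n) k i ω ∂(P n)) - c| ≤ v n) :
    (∀ᶠ n in atTop, 0 < BootstrapKendall.kendallSD (P n) (X n)) ∧
    ∀ ε : ℝ, 0 < ε → ∀ᶠ n in atTop, ∀ᵐ ω ∂P n,
      |BootstrapKendall.bootstrapVar
          (fun x => (BootstrapKendall.kendallSD (P n) (X n))⁻¹ * BootstrapKendall.kendallU x)
          (fun i => X n i ω)
        - variance (fun ω' => (BootstrapKendall.kendallSD (P n) (X n))⁻¹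
            * BootstrapKendall.kendallU (fun i => X n i ω')) (P n)| < ε := by
  open BootstrapKendall in
  have hranks : ∀ n, NearlyUniformRanks (P n) (X n) (2 * (|u n| + |v n|)) := fun n =>
    nearlyUniformRanks_of_probGT (hmeas n) (hindep n) (by positivity)
      (fun i j hij => (hpair n i j hij).trans
        ((le_abs_self _).trans (le_add_of_nonneg_right (abs_nonneg _))))
      fun i j k hij hik hjk => (htriple n i j k hij hik hjk).trans
        ((le_abs_self _).trans (le_add_of_nonneg_left (abs_nonneg _)))
  have herror : Tendsto (fun n => 2 * (|u n| + |v n|)) atTop (𝓝 0) := by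
    simpa using (hu.abs.add hv.abs).const_mul 2
  refine ⟨eventually_kendallSD_pos hranks herror, fun ε hε => ?_⟩
  filter_upwards [eventually_abs_bootstrapVar_sub_variance_lt hranks herror hε] with n hn
  filter_upwards [ae_injective_of_pairwise_indepFun (hmeas n) fun i j => (hindep n).indepFun]
    with ω hω using hn _ hω

theorem mainTheorem9
    {Ω : ℕ → Type*} [∀ n, MeasurableSpace (Ω n)]
    (P : ∀ n, Measure (Ω n)) [∀ n, IsProbabilityMeasure (P n)]
    -- a triangular array with independent, absolutely continuous rows
    (X : ∀ n, Fin n → Ω n → ℝ)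
    (hmeas : ∀ n i, Measurable (X n i))
    (hindep : ∀ n, iIndepFun (X n) (P n))
    (hac : ∀ n i, (P n).map (X n i) ≪ volume)
    -- the degree of heterogeneity
    (δ p : ℕ → ℝ)
    (hδ : ∀ n, δ n ∈ Set.Ioo (0 : ℝ) 1)
    (hp : ∀ n, p n ∈ Set.Ioo (0 : ℝ) 1)
    (hspread : ∀ᶠ n in atTop, ∀ i : Fin n,
      p n ≤ (P n).real {ω | ∀ j : Fin n, j ≠ i →
          BootstrapKendall.condProbGT (P n) (X n) j i ω
            - BootstrapKendall.probGT (P n) (X n) j i ∈ Set.Icc (δ n) 1} ∨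
      p n ≤ (P n).real {ω | ∀ j : Fin n, j ≠ i →
          BootstrapKendall.condProbGT (P n) (X n) j i ω
            - BootstrapKendall.probGT (P n) (X n) j i ∈ Set.Icc (-1) (-δ n)})
    (hrate : BootstrapKendall.StrictlyDominates
      (fun n => δ n ^ 3 * p n) (fun n => (n : ℝ) ^ (-(1 / 3) : ℝ)))
    -- homogeneity of the pairwise probabilities
    (θ C : ℝ) (hθ : 0 < θ) (hC : 0 < C)
    (hpair : ∀ n, ∀ i j : Fin n, i ≠ j →
      |BootstrapKendall.probGT (P n) (X n) i j - θ| ≤ C * (n : ℝ) ^ (-(1 / 6) : ℝ))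
    (η C' : ℝ) (hη : 0 < η ^ 2) (hC' : 0 < C')
    (htriple : ∀ n, ∀ i j k : Fin n, j ≠ i → k ≠ i →
      |(∫ ω, BootstrapKendall.condProbGT (P n) (X n) j i ω
          * BootstrapKendall.condProbGT (P n) (X n) k i ω ∂(P n)) - η ^ 2|
        ≤ C' * (n : ℝ) ^ (-(1 / 3) : ℝ))
    (hne : η ^ 2 ≠ θ ^ 2) :
    (∀ᶠ n in atTop, 0 < BootstrapKendall.kendallSD (P n) (X n)) ∧
    ∀ ε : ℝ, 0 < ε →
      Tendsto (fun n => P n {ω | ε ≤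
        |BootstrapKendall.bootstrapVar
            (fun x => (BootstrapKendall.kendallSD (P n) (X n))⁻¹ * BootstrapKendall.kendallU x)
            (fun i => X n i ω)
          - variance (fun ω' => (BootstrapKendall.kendallSD (P n) (X n))⁻¹
              * BootstrapKendall.kendallU (fun i => X n i ω')) (P n)|})
        atTop (𝓝 0) := by
  have : ∀ n i, NullSingletonClass ((P n).map (X n i)) := fun n i =>
    ⟨fun _ => hac n i Real.volume_singleton⟩
  have hlimit := mainTheorem9_general P X hmeas hindep θ (η ^ 2) _ _
    (BootstrapKendall.tendsto_const_mul_natCast_rpow_neg C (by norm_num))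
    (BootstrapKendall.tendsto_const_mul_natCast_rpow_neg C' (by norm_num)) hpair
    fun n i j k hij hik _ => htriple n i j k hij.symm hik.symm
  exact ⟨hlimit.1, fun ε hε =>
    BootstrapKendall.tendsto_measure_of_eventually_ae_lt (hlimit.2 ε hε)⟩
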